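/- Let $0<\epsilon\le 1/2$ and consider the typewriter channel with input and output alphabet $\mathbb{Z}_5$ and transition probabilities $W(x\,|\,x)=1-\epsilon$, $W(x+1\,|\,x)=\epsilon$. All logarithms are to base 2. Let $\mathsf{P}_{\mathrm e}(M,n)$ be the smallest probability of error of codes with $M$ codewords of length $n$, and let $$E(R)=\limsup_{n\to\infty}\frac1n\log\frac{1}{\mathsf{P}_{\mathrm e}(\lceil 2^{nR}\rceil,n)}\in[0,\infty]$$ be the reliability function (with $\log(1/0)=+\infty$). Put $\alpha_\epsilon=\sqrt{\epsilon(1-\epsilon)}$ and $h_5(x)=x\log 4-x\log x-(1-x)\log(1-x)$; for $0\le r\le\log 5$ let $\delta_{GV}(r;5)$ be the unique $\delta\in[0,4/5]$ with $r=\log 5-h_5(\delta)$; and put $$R_+^*(\epsilon;5)=\log 5-\tfrac12\,h_5\!\left(1-\frac1{(1+2\alpha_\epsilon)^2}\right).$$ Then for every $R$ with $\log\sqrt5\le R\le R_+^*(\epsilon;5)$, $$E(R)\ \ge\ -\tfrac12\,\delta_{GV}(2R-\log 5;5)\,\log\bigl(\alpha_\epsilon(1+\alpha_\epsilon)\bigr),$$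 both when the probability of error is averaged over the codewords and when it is the maximum over the codewords. Moreover, if $R<R_+^*(\epsilon;5)$, the right-hand side is strictly larger than the multiletter expurgated exponent $E_{\mathrm{ex}}^\infty(R)=\sup_{k\ge1}\sup_{\rho\ge1}\bigl[-\frac{\rho}{k}\log\min_P\sum_{\mathbf{x}_1,\mathbf{x}_2}P(\mathbf{x}_1)P(\mathbf{x}_2)\,g_k(\mathbf{x}_1,\mathbf{x}_2)^{1/\rho}-\rho R\bigr]$, where $P$ ranges over the probability distributions on $\mathbb{Z}_5^k$, $g_k(\mathbf{x}_1,\mathbf{x}_2)=\sum_{\mathbf{y}\in\mathbb{Z}_5^k}\sqrt{\mathbf{W}(\mathbf{y}|\mathbf{x}_1)\mathbf{W}(\mathbf{y}|\mathbf{x}_2)}$, and $\mathbf{W}$ is the $k$-fold memoryless extension of $W$. -/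

import Mathlib

namespace Typewriter

noncomputable section

/-- Transition probability `W(y | x)` of the typewriter channel on `ℤ/qℤ`
with crossover probability `ε`. -/
def channel (q : ℕ) (ε : ℝ) (x y : ZMod q) : ℝ :=
  if y = x then 1 - ε else if y = x + 1 then ε else 0

/-- The `n`-fold memoryless extension of the channel. -/
def channelN (q : ℕ) (ε : ℝ) (n : ℕ) (x y : Fin n → ZMod q) : ℝ :=
  ∏ i, channel q ε (x i) (y i)

/-- A block code of length `n` with `M` messages over the alphabet `ℤ/qℤ`. -/
structure Code (q M n : ℕ) where
  enc : Fin M → (Fin n → ZMod q)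
  dec : (Fin n → ZMod q) → Fin M

/-- Probability that message `m` is decoded incorrectly. -/
def Code.msgError {q M n : ℕ} [NeZero q] (c : Code q M n) (ε : ℝ) (m : Fin M) : ℝ :=
  ∑ y : Fin n → ZMod q, if c.dec y = m then 0 else channelN q ε n (c.enc m) y

/-- Average (over messages) probability of error. -/
def Code.avgError {q M n : ℕ} [NeZero q] (c : Code q M n) (ε : ℝ) : ℝ :=
  (1 / (M : ℝ)) * ∑ m : Fin M, c.msgError ε m

/-- Maximal (over messages) probability of error. -/
def Code.maxError {q M n : ℕ} [NeZero q] (c : Code q M n) (ε : ℝ) : ℝ :=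
  ⨆ m : Fin M, c.msgError ε m

/-- Smallest average probability of error of codes with `M` codewords of length `n`. -/
def minAvgError (q : ℕ) [NeZero q] (ε : ℝ) (M n : ℕ) : ℝ :=
  ⨅ c : Code q M n, c.avgError ε

/-- Smallest maximal probability of error of codes with `M` codewords of length `n`. -/
def minMaxError (q : ℕ) [NeZero q] (ε : ℝ) (M n : ℕ) : ℝ :=
  ⨅ c : Code q M n, c.maxError ε

/-- `(1/n) log₂ (1/p)`, with value `+∞` when `p = 0`. -/
def expRate (n : ℕ) (p : ℝ) : EReal :=
  if p = 0 then ⊤ else (((1 / (n : ℝ)) * Real.logb 2 (1 / p) : ℝ) : EReal)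

/-- The reliability function `limsup_n (1/n) log₂ (1 / P_e(⌈2^{nR}⌉, n))`,
for the average probability of error. -/
def reliability (q : ℕ) [NeZero q] (ε R : ℝ) : EReal :=
  Filter.limsup
    (fun n : ℕ => expRate n (minAvgError q ε ⌈(2 : ℝ) ^ ((n : ℝ) * R)⌉₊ n)) Filter.atTop

/-- The reliability function for the maximal probability of error. -/
def reliabilityMax (q : ℕ) [NeZero q] (ε R : ℝ) : EReal :=
  Filter.limsup
    (fun n : ℕ => expRate n (minMaxError q ε ⌈(2 : ℝ) ^ ((n : ℝ) * R)⌉₊ n)) Filter.atTop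

/-- `α_ε = √(ε (1 - ε))`. -/
def alpha (ε : ℝ) : ℝ := Real.sqrt (ε * (1 - ε))

/-- The `q`-ary entropy function in bits:
`h_q(x) = x log₂ (q-1) - x log₂ x - (1-x) log₂ (1-x)`. -/
def entropy (q : ℕ) (x : ℝ) : ℝ := Real.qaryEntropy q x / Real.log 2

/-- The relative Gilbert–Varshamov distance: the `δ ∈ [0, 1 - 1/q]` with
`r = log₂ q - h_q(δ)` (it exists and is unique for `q ≥ 2` and `0 ≤ r ≤ log₂ q`). -/
def deltaGV (r : ℝ) (q : ℕ) : ℝ :=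
  sSup {δ : ℝ | 0 ≤ δ ∧ δ ≤ 1 - 1 / (q : ℝ) ∧ r = Real.logb 2 q - entropy q δ}

/-- The rate `R₊*(ε; 5)`. -/
def RPlus5 (ε : ℝ) : ℝ :=
  Real.logb 2 5 - (1 / 2) * entropy 5 (1 - 1 / (1 + 2 * alpha ε) ^ 2)

/-- The kernel `g_k(x₁, x₂) = ∑_y √(W(y|x₁) W(y|x₂))` on blocks of length `k`. -/
def bhatt (q : ℕ) [NeZero q] (ε : ℝ) (k : ℕ) (x₁ x₂ : Fin k → ZMod q) : ℝ :=
  ∑ y : Fin k → ZMod q, Real.sqrt (channelN q ε k x₁ y * channelN q ε k x₂ y)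

/-- The quadratic form `Q^k(ρ, P)`. -/
def quadForm (q : ℕ) [NeZero q] (ε : ℝ) (k : ℕ) (ρ : ℝ) (P : (Fin k → ZMod q) → ℝ) : ℝ :=
  ∑ x₁, ∑ x₂, P x₁ * P x₂ * bhatt q ε k x₁ x₂ ^ (1 / ρ)

/-- `E_x^k(ρ) = -(ρ/k) log₂ min_P Q^k(ρ, P)`, over all probability vectors `P` on blocks of
length `k`. -/
def exFun (q : ℕ) [NeZero q] (ε : ℝ) (k : ℕ) (ρ : ℝ) : ℝ :=
  -(ρ / (k : ℝ)) *
    Real.logb 2 (⨅ P : stdSimplex ℝ (Fin k → ZMod q), quadForm q ε k ρ P.1)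

/-- The `k`-letter expurgated exponent `E_ex^k(R) = sup_{ρ ≥ 1} (E_x^k(ρ) - ρ R)`. -/
def expurgated (q : ℕ) [NeZero q] (ε : ℝ) (k : ℕ) (R : ℝ) : EReal :=
  ⨆ (ρ : ℝ) (_ : 1 ≤ ρ), ((exFun q ε k ρ - ρ * R : ℝ) : EReal)

/-- The multiletter expurgated exponent `E_ex^∞(R) = sup_{k ≥ 1} E_ex^k(R)`. -/
def expurgatedInf (q : ℕ) [NeZero q] (ε R : ℝ) : EReal :=
  ⨆ (k : ℕ) (_ : 1 ≤ k), expurgated q ε k R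

/-- The lower bound `-½ δ_GV(2R - log₂ 5; 5) log₂ (α_ε (1 + α_ε))`. -/
def newBound5 (ε R : ℝ) : ℝ :=
  -(1 / 2) * deltaGV (2 * R - Real.logb 2 5) 5 * Real.logb 2 (alpha ε * (1 + alpha ε))

end

end Typewriter

namespace Typewriter

open Finset

/-! The Bhattacharyya kernel of the channel is supported on the pentagon with loops, and `(x, 2x)`
is Shannon's zero-error code of length 2 for it. The codes used here are unions of translates `(x,
2x + c j)` of its `m`-fold power. Summed over a whole translate, the kernel depends only on where
the shifts differ (`sum_append_bhatt`): each differing coordinate costs `β = α(1 + α)`. The union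
bound thus becomes an energy of the outer words `c j`. A minimal-energy family for the kernel with
off-diagonal value `b`, where `b ^ ρ = β`, bounds this energy (`exists_family_sum_pow_le`). Taking
`b / (1 - b)`-style tilting into account, the choice `δ = 4b / (1 + 4b)` turns the bound into `exp
(m δ log β)`; the condition `b ≥ β`, i.e. `ρ ≥ 1`, comes from `R ≤ R₊*`.

For the comparison, `circulant a 0` is positive semidefinite up to `a = (√5 - 1) / 2`, so no input
distribution on blocks beats the constant component (`le_quadForm`) and block length gives no gain.
Beyond that threshold the terms are at most 0, since `R ≥ log √5`. Below it, Gibbs' inequality and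
subadditivity of `t ↦ t ^ (1/ρ)` put each term strictly under the new bound, and compactness in `ρ`
keeps the supremum strictly under it. -/

/-! ### Pentagon kernels and their sums. -/

/-- The kernel on `ℤ/5ℤ` with value `1` on the diagonal, `p` on cyclically adjacent pairs and `q`
on the remaining pairs. -/
noncomputable def circulant (p q : ℝ) (x y : ZMod 5) : ℝ :=
  if y = x then 1 else if y = x + 1 ∨ x = y + 1 then p else q

theorem sum_zmod_five (f : ZMod 5 → ℝ) : ∑ z, f z = f 0 + f 1 + f 2 + f 3 + f 4 :=
  Fin.sum_univ_five f

theorem zmod_five_cases (d : ZMod 5) : d = 0 ∨ d = 1 ∨ d = 2 ∨ d = 3 ∨ d = 4 := by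
  revert d; decide

theorem circulant_add_left (p q : ℝ) (t x y : ZMod 5) :
    circulant p q (t + x) (t + y) = circulant p q x y := by
  simp [circulant, add_assoc]

theorem channel_add_left (ε : ℝ) (t x y : ZMod 5) :
    channel 5 ε (t + x) (t + y) = channel 5 ε x y := by
  simp [channel, add_assoc]

theorem circulant_self (p q : ℝ) (x : ZMod 5) : circulant p q x x = 1 := by simp [circulant]

theorem circulant_nonneg {p : ℝ} (hp : 0 ≤ p) (x y : ZMod 5) : 0 ≤ circulant p 0 x y := by
  unfold circulant; split_ifs <;> norm_num [hp]

theorem circulant_mono {p p' : ℝ} (h : p ≤ p') (x y : ZMod 5) :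
    circulant p 0 x y ≤ circulant p' 0 x y := by
  unfold circulant; split_ifs <;> simp [h]

theorem circulant_rpow (p : ℝ) {s : ℝ} (hs : s ≠ 0) (x y : ZMod 5) :
    circulant p 0 x y ^ s = circulant (p ^ s) 0 x y := by
  unfold circulant; split_ifs <;> simp [hs]

theorem sum_sqrt_channel {ε : ℝ} (h0 : 0 ≤ ε) (h1 : ε ≤ 1) (x y : ZMod 5) :
    ∑ z, √(channel 5 ε x z * channel 5 ε y z) = circulant (alpha ε) 0 x y := by
  obtain ⟨d, rfl⟩ : ∃ d, y = x + d := ⟨y - x, by ring⟩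
  have e1 : √((1 - ε) * (1 - ε)) = 1 - ε := Real.sqrt_mul_self (by linarith)
  have e2 : √(ε * ε) = ε := Real.sqrt_mul_self h0
  have key : ∑ z, √(channel 5 ε 0 z * channel 5 ε d z) = circulant (alpha ε) 0 0 d := by
    rw [sum_zmod_five]
    rcases zmod_five_cases d with rfl | rfl | rfl | rfl | rfl <;>
    simp +decide [channel, circulant, alpha, e1, e2, mul_comm]
  have h2 : ∀ z, channel 5 ε x (x + z) = channel 5 ε 0 z := fun z => by
    simpa using channel_add_left ε x 0 z
  have h3 : circulant (alpha ε) 0 x (x + d) = circulant (alpha ε) 0 0 d := by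
    simpa using circulant_add_left (alpha ε) 0 x 0 d
  rw [← Equiv.sum_comp (Equiv.addLeft x), h3, ← key]
  simp only [Equiv.coe_addLeft, h2, channel_add_left]

/-- Doubling exchanges the differences `±1` and `±2`. For equal shifts only `d = x` survives; for
distinct shifts exactly two terms survive, `a` and `a ^ 2`. -/
theorem sum_circulant_mul_circulant_dilate (a : ℝ) (x u v : ZMod 5) :
    ∑ d, circulant a 0 x d * circulant a 0 (2 * x + u) (2 * d + v) =
      if u = v then 1 else a * (1 + a) := by
  obtain ⟨w, rfl⟩ : ∃ w, v = u + w := ⟨v - u, by ring⟩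
  have key : ∑ d, circulant a 0 0 d * circulant a 0 0 (2 * d + w) =
      if w = 0 then 1 else a * (1 + a) := by
    rw [sum_zmod_five]
    rcases zmod_five_cases w with rfl | rfl | rfl | rfl | rfl <;>
      simp +decide [circulant] <;> ring
  have h1 : ∀ d, circulant a 0 x (x + d) = circulant a 0 0 d := fun d => by
    simpa using circulant_add_left a 0 x 0 d
  have h2 : ∀ d, circulant a 0 (2 * x + u) (2 * (x + d) + (u + w)) =
      circulant a 0 0 (2 * d + w) := fun d => by
    rw [← circulant_add_left a 0 (2 * x + u) 0 (2 * d + w)]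
    congr 1 <;> ring
  rw [← Equiv.sum_comp (Equiv.addLeft x)]
  simp only [Equiv.coe_addLeft, h1, h2, key]
  simp

theorem sum_circulant_mul_circulant (p q : ℝ) (x y : ZMod 5) :
    ∑ s, circulant p q s x * circulant p q s y =
      if y = x then 1 + 2 * p ^ 2 + 2 * q ^ 2
      else if y = x + 1 ∨ x = y + 1 then 2 * p + 2 * p * q + q ^ 2
      else 2 * q + 2 * p * q + p ^ 2 := by
  obtain ⟨d, rfl⟩ : ∃ d, y = x + d := ⟨y - x, by ring⟩
  rw [← Equiv.sum_comp (Equiv.addLeft x)]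
  have h1 : ∀ s, circulant p q (x + s) x = circulant p q s 0 := fun s => by
    simpa using circulant_add_left p q x s 0
  simp only [Equiv.coe_addLeft, h1, circulant_add_left, add_eq_left, add_right_inj]
  rw [sum_zmod_five]
  rcases zmod_five_cases d with rfl | rfl | rfl | rfl | rfl <;>
    simp +decide [circulant, add_assoc] <;> ring

theorem bhatt_eq_prod {ε : ℝ} (h0 : 0 ≤ ε) (h1 : ε ≤ 1) (n : ℕ) (x y : Fin n → ZMod 5) :
    bhatt 5 ε n x y = ∏ i, circulant (alpha ε) 0 (x i) (y i) := by
  have hc : ∀ a b, 0 ≤ channel 5 ε a b := fun a b => by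
    unfold channel; split_ifs <;> linarith
  simp_rw [← sum_sqrt_channel h0 h1, Fintype.prod_sum, bhatt, channelN, ← prod_mul_distrib]
  exact sum_congr rfl fun z _ => Real.sqrt_prod _ fun i _ => mul_nonneg (hc _ _) (hc _ _)

/-! ### Positive semidefiniteness and quadratic forms on blocks. -/

/-- The kernel `circulant a 0` is positive semidefinite for `0 ≤ a ≤ (√5 - 1) / 2`, with an
explicit decomposition into rank one terms, the first of which is constant. -/
theorem exists_circulant_decomposition {a : ℝ} (ha0 : 0 ≤ a) (ha : a ≤ (√5 - 1) / 2) :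
    ∃ (w : Option (Bool × ZMod 5) → ℝ) (B : Option (Bool × ZMod 5) → ZMod 5 → ℝ),
      (∀ t, 0 ≤ w t) ∧ w none = (1 + 2 * a) / 5 ∧ (∀ x, B none x = 1) ∧
      ∀ x y, ∑ t, w t * (B t x * B t y) = circulant a 0 x y := by
  have hs : √5 ^ 2 = 5 := Real.sq_sqrt (by norm_num)
  have hs1 : 1 ≤ √5 := Real.one_le_sqrt.2 (by norm_num)
  -- `c = cos (2π/5)` and `d = cos (4π/5)`. The rank one terms are translated cosines, whose sums
  -- give the nontrivial Fourier projections; `1 + 2ac` and `1 + 2ad` are the eigenvalues.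
  set c := (√5 - 1) / 4 with hc
  set d := -(√5 + 1) / 4 with hd
  refine ⟨fun t => t.elim ((1 + 2 * a) / 5) fun t =>
      if t.1 then 4 / 25 * (1 + 2 * a * c) else 4 / 25 * (1 + 2 * a * d),
    fun t x => t.elim 1 fun t => if t.1 then circulant c d t.2 x else circulant d c t.2 x,
    ?_, rfl, fun x => rfl, ?_⟩
  · rintro (_ | ⟨_ | _, s⟩)
    · simp only [Option.elim]; positivity
    · have : 0 ≤ 1 + 2 * a * d := by
        have : 0 ≤ ((√5 - 1) / 2 - a) * (√5 + 1) := mul_nonneg (by linarith) (by linarith)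
        rw [hd]; nlinarith
      simpa using this
    · have : 0 ≤ c := by rw [hc]; linarith
      simp only [Option.elim, if_true]; positivity
  · intro x y
    simp only [Fintype.sum_option, Fintype.sum_prod_type, Fintype.sum_bool, Option.elim, if_true,
      Bool.false_eq_true, if_false, ← mul_sum, sum_circulant_mul_circulant]
    unfold circulant
    rw [hc, hd]
    generalize √5 = z at *
    split_ifs
    · linear_combination (2 / 25 - a / 25) * hs
    · linear_combination (-1 / 50 + 11 * a / 100) * hs
    · linear_combination (-1 / 50 - 9 * a / 100) * hs

/-- Tensoring the decomposition writes the form as a nonnegative combination of squares; only the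
square of the constant component, equal to 1, is kept. -/
theorem pow_le_quadraticForm {X T : Type*} [Fintype X] [Fintype T] {K : X → X → ℝ} {w : T → ℝ}
    {B : T → X → ℝ} (hw : ∀ t, 0 ≤ w t) (hK : ∀ x y, ∑ t, w t * (B t x * B t y) = K x y)
    {t₀ : T} (hB : ∀ x, B t₀ x = 1) (k : ℕ) {P : (Fin k → X) → ℝ} (hP : ∑ x, P x = 1) :
    w t₀ ^ k ≤ ∑ x, ∑ y, P x * P y * ∏ i, K (x i) (y i) := by
  classical
  have key : ∑ x, ∑ y, P x * P y * ∏ i, K (x i) (y i) =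
      ∑ t : Fin k → T, (∏ i, w (t i)) * (∑ x, P x * ∏ i, B (t i) (x i)) ^ 2 := by
    simp_rw [← hK, Fintype.prod_sum, sq, sum_mul_sum, mul_sum]
    rw [sum_comm (s := (univ : Finset (Fin k → T)))]
    refine sum_congr rfl fun x _ => ?_
    rw [sum_comm]
    refine sum_congr rfl fun t _ => sum_congr rfl fun y _ => ?_
    rw [prod_mul_distrib, prod_mul_distrib]
    ring
  rw [key]
  refine le_trans (le_of_eq ?_) (single_le_sum (f := fun t : Fin k → T =>
    (∏ i, w (t i)) * (∑ x, P x * ∏ i, B (t i) (x i)) ^ 2) (fun t _ => mul_nonneg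
      (prod_nonneg fun i _ => hw _) (sq_nonneg _)) (mem_univ fun _ => t₀))
  simp [hB, hP]

/-! ### Union bound and the code built from translates. -/

theorem channelN_nonneg {q : ℕ} {ε : ℝ} (h0 : 0 ≤ ε) (h1 : ε ≤ 1) (n : ℕ)
    (x y : Fin n → ZMod q) : 0 ≤ channelN q ε n x y :=
  prod_nonneg fun i _ => by unfold channel; split_ifs <;> linarith

/-- The Bhattacharyya union bound for maximum likelihood decoding. -/
theorem exists_decoder_msgError_le {q M n : ℕ} [NeZero q] [NeZero M] {ε : ℝ} (h0 : 0 ≤ ε)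
    (h1 : ε ≤ 1) (enc : Fin M → Fin n → ZMod q) :
    ∃ dec, ∀ m, (⟨enc, dec⟩ : Code q M n).msgError ε m ≤
      ∑ m' ∈ univ.erase m, bhatt q ε n (enc m) (enc m') := by
  have hW := channelN_nonneg (q := q) h0 h1 n
  choose dec hdec using fun y => Finite.exists_max fun m => channelN q ε n (enc m) y
  refine ⟨dec, fun m => ?_⟩
  simp only [Code.msgError, bhatt]
  rw [sum_comm]
  refine sum_le_sum fun y _ => ?_
  split_ifs with h
  · exact sum_nonneg fun _ _ => Real.sqrt_nonneg _
  · refine le_trans ?_ (single_le_sum (f := fun m' =>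
      √(channelN q ε n (enc m) y * channelN q ε n (enc m') y))
      (fun _ _ => Real.sqrt_nonneg _) (mem_erase.2 ⟨h, mem_univ _⟩))
    refine Real.le_sqrt_of_sq_le ?_
    rw [sq]
    exact mul_le_mul_of_nonneg_left (hdec y m) (hW _ _)

theorem sum_append_bhatt {ε : ℝ} (h0 : 0 ≤ ε) (h1 : ε ≤ 1) {m : ℕ} (x u v : Fin m → ZMod 5) :
    ∑ x' : Fin m → ZMod 5, bhatt 5 ε (m + m) (Fin.append x (2 * x + u)) (Fin.append x' (2 * x' + v))
      = ∏ i, if u i = v i then 1 else alpha ε * (1 + alpha ε) := by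
  rw [prod_congr rfl fun i _ =>
    (sum_circulant_mul_circulant_dilate (alpha ε) (x i) (u i) (v i)).symm, Fintype.prod_sum]
  refine sum_congr rfl fun x' _ => ?_
  rw [bhatt_eq_prod h0 h1, Fin.prod_univ_add, prod_mul_distrib]
  simp only [Fin.append_left, Fin.append_right]
  rfl

/-- A family `c` of `N` words over `ℤ/5ℤ` gives a code with `5 ^ m * N` codewords
`(x, 2 x + c j)`. -/
theorem exists_code_maxError_le {ε : ℝ} (h0 : 0 ≤ ε) (h1 : ε ≤ 1) {m M N : ℕ} (hM : 0 < M)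
    (hMN : M ≤ 5 ^ m * N) (c : Fin N → Fin m → ZMod 5) {S : ℝ}
    (hS : ∀ j, ∑ k ∈ univ.erase j, ∏ i, (if c j i = c k i then 1 else alpha ε * (1 + alpha ε)) ≤ S) :
    ∃ C : Code 5 M (m + m), ∀ μ, C.msgError ε μ ≤ S := by
  have : NeZero M := ⟨hM.ne'⟩
  have hcard : Fintype.card (Fin M) ≤ Fintype.card ((Fin m → ZMod 5) × Fin N) := by
    simpa [ZMod.card] using hMN
  obtain ⟨e⟩ := Function.Embedding.nonempty_of_card_le hcard
  let word : (Fin m → ZMod 5) × Fin N → Fin (m + m) → ZMod 5 :=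
    fun p => Fin.append p.1 (2 * p.1 + c p.2)
  obtain ⟨dec, hdec⟩ := exists_decoder_msgError_le (q := 5) h0 h1 fun μ => word (e μ)
  refine ⟨⟨_, dec⟩, fun μ => (hdec μ).trans (le_trans ?_ (hS (e μ).2))⟩
  have hb : ∀ p p', 0 ≤ bhatt 5 ε (m + m) (word p) (word p') := fun p p' =>
    sum_nonneg fun _ _ => Real.sqrt_nonneg _
  have hself : bhatt 5 ε (m + m) (word (e μ)) (word (e μ)) = 1 := by
    rw [bhatt_eq_prod h0 h1]; simp [circulant_self]
  calc ∑ μ' ∈ univ.erase μ, bhatt 5 ε (m + m) (word (e μ)) (word (e μ'))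
      = ∑ p ∈ (univ.erase μ).map e, bhatt 5 ε (m + m) (word (e μ)) (word p) := by rw [sum_map]
    -- Adding the unused words only increases the sum, and makes complete translates available. The
    -- word's own translate then contributes exactly the self term 1.
    _ ≤ ∑ p ∈ univ.erase (e μ), bhatt 5 ε (m + m) (word (e μ)) (word p) := by
        refine sum_le_sum_of_subset_of_nonneg (fun p hp => ?_) fun _ _ _ => hb _ _
        obtain ⟨μ', hμ', rfl⟩ := mem_map.1 hp
        simpa using hμ'
    _ = ∑ p, bhatt 5 ε (m + m) (word (e μ)) (word p) - 1 := by
        rw [← add_sum_erase univ _ (mem_univ (e μ)), hself]; ring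
    _ = ∑ k, ∏ i, (if c (e μ).2 i = c k i then 1 else alpha ε * (1 + alpha ε)) - 1 := by
        rw [Fintype.sum_prod_type_right]
        simp only [word, sum_append_bhatt h0 h1]
    _ = _ := by
        rw [← add_sum_erase univ _ (mem_univ (e μ).2)]; simp

/-! ### Outer words of small energy. -/

/-- A family of points minimizing the total energy of a symmetric kernel has, at each of its
points, at most the average energy. -/
theorem exists_family_sum_le {V : Type*} [Fintype V] [Nonempty V] (κ : V → V → ℝ)
    (hsymm : ∀ u v, κ u v = κ v u) {d A : ℝ} (hdiag : ∀ v, κ v v = d)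
    (hA : ∀ u, ∑ v, κ v u ≤ Fintype.card V * A) (N : ℕ) :
    ∃ c : Fin N → V, ∀ j, ∑ k ∈ univ.erase j, κ (c j) (c k) ≤ (N - 1) * A := by
  classical
  obtain ⟨c, hc⟩ := Finite.exists_min fun c : Fin N → V => ∑ j, ∑ k, κ (c j) (c k)
  refine ⟨c, fun j => ?_⟩
  have split : ∀ b : Fin N → V, ∑ i, ∑ k, κ (b i) (b k) = d +
      2 * ∑ k ∈ univ.erase j, κ (b j) (b k) +
      ∑ i ∈ univ.erase j, ∑ k ∈ univ.erase j, κ (b i) (b k) := fun b => by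
    have h1 : ∀ i, ∑ k, κ (b i) (b k) = κ (b j) (b i) + ∑ k ∈ univ.erase j, κ (b i) (b k) :=
      fun i => by rw [← add_sum_erase univ _ (mem_univ j), hsymm]
    rw [← add_sum_erase univ _ (mem_univ j), h1, hdiag]
    simp_rw [h1, sum_add_distrib]
    ring
  -- Moving only the `j`-th point cannot lower the total energy; averaging over its new position `v`
  -- gives the claim. Repeated points are allowed, so no distinctness is needed.
  have hmin : ∀ v, ∑ k ∈ univ.erase j, κ (c j) (c k) ≤ ∑ k ∈ univ.erase j, κ v (c k) := fun v => by
    have h := hc (Function.update c j v)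
    have hu : ∀ k ∈ univ.erase j, Function.update c j v k = c k := fun k hk =>
      Function.update_of_ne (ne_of_mem_erase hk) _ _
    rw [split, split (Function.update c j v)] at h
    have e1 : ∑ k ∈ univ.erase j, κ v (Function.update c j v k) =
        ∑ k ∈ univ.erase j, κ v (c k) := sum_congr rfl fun k hk => by rw [hu k hk]
    have e2 : ∑ i ∈ univ.erase j, ∑ k ∈ univ.erase j,
        κ (Function.update c j v i) (Function.update c j v k) =
        ∑ i ∈ univ.erase j, ∑ k ∈ univ.erase j, κ (c i) (c k) :=
      sum_congr rfl fun i hi => sum_congr rfl fun k hk => by rw [hu i hi, hu k hk]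
    rw [Function.update_self, e1, e2] at h
    linarith
  have hcard : (0 : ℝ) < Fintype.card V := by exact_mod_cast Fintype.card_pos
  have hsum : Fintype.card V * ∑ k ∈ univ.erase j, κ (c j) (c k) ≤
      Fintype.card V * ((N - 1) * A) := by
    calc Fintype.card V * ∑ k ∈ univ.erase j, κ (c j) (c k)
        = ∑ _v : V, ∑ k ∈ univ.erase j, κ (c j) (c k) := by
          rw [sum_const, card_univ, nsmul_eq_mul]
      _ ≤ ∑ v, ∑ k ∈ univ.erase j, κ v (c k) := sum_le_sum fun v _ => hmin v
      _ = ∑ k ∈ univ.erase j, ∑ v, κ v (c k) := sum_comm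
      _ ≤ ∑ k ∈ univ.erase j, Fintype.card V * A := sum_le_sum fun k _ => hA _
      _ = Fintype.card V * ((N - 1) * A) := by
        have : 1 ≤ N := j.pos
        rw [sum_const, card_erase_of_mem (mem_univ j), card_univ, Fintype.card_fin, nsmul_eq_mul]
        push_cast [Nat.cast_sub this]
        ring
  exact le_of_mul_le_mul_left hsum hcard

theorem sum_rpow_le_rpow_sum {ι : Type*} (s : Finset ι) {f : ι → ℝ} (hf : ∀ i ∈ s, 0 ≤ f i)
    {ρ : ℝ} (hρ : 1 ≤ ρ) : ∑ i ∈ s, f i ^ ρ ≤ (∑ i ∈ s, f i) ^ ρ := by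
  have hsplit : ∀ x : ℝ, 0 ≤ x → x ^ ρ = x * x ^ (ρ - 1) := fun x hx => by
    rw [← Real.rpow_one_add' hx (by linarith)]; congr 1; ring
  rw [hsplit _ (sum_nonneg hf), sum_mul]
  refine sum_le_sum fun i hi => ?_
  rw [hsplit _ (hf i hi)]
  exact mul_le_mul_of_nonneg_left (Real.rpow_le_rpow (hf i hi) (single_le_sum hf hi)
    (by linarith)) (hf i hi)

/-- Here `ρ` is the expurgation parameter: energy is minimized for `b`, not `b ^ ρ`, and
superadditivity of `t ↦ t ^ ρ` then transfers the bound. -/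
theorem exists_family_sum_pow_le {b ρ : ℝ} (hb : 0 ≤ b) (hρ : 1 ≤ ρ) (m N : ℕ) :
    ∃ c : Fin N → Fin m → ZMod 5, ∀ j, ∑ k ∈ univ.erase j,
      ∏ i, (if c j i = c k i then 1 else b ^ ρ) ≤ ((N - 1) * ((1 + 4 * b) / 5) ^ m) ^ ρ := by
  have hK0 : ∀ u v : ZMod 5, 0 ≤ if u = v then 1 else b := fun u v => by
    split_ifs <;> norm_num [hb]
  have hprod : ∀ u v : Fin m → ZMod 5, 0 ≤ ∏ i, if u i = v i then 1 else b := fun u v =>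
    prod_nonneg fun i _ => hK0 _ _
  obtain ⟨c, hc⟩ := exists_family_sum_le
    (fun u v : Fin m → ZMod 5 => ∏ i, if u i = v i then 1 else b)
    (fun u v => by simp only [eq_comm]) (d := 1) (A := ((1 + 4 * b) / 5) ^ m) (by simp)
    (fun u => by
      rw [← Fintype.prod_sum fun i y => if y = u i then (1 : ℝ) else b]
      have : ∀ a : ZMod 5, ∑ y, (if y = a then (1 : ℝ) else b) = 1 + 4 * b := fun a => by
        rw [← add_sum_erase univ _ (mem_univ a), sum_congr rfl fun y hy =>
          if_neg (ne_of_mem_erase hy)]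
        simp [card_erase_of_mem, ZMod.card]
      simp only [this]
      rw [prod_const, card_univ, Fintype.card_fin, Fintype.card_fun, ZMod.card, Fintype.card_fin,
        div_pow]
      push_cast
      exact (mul_div_cancel₀ _ (by positivity)).ge) N
  refine ⟨c, fun j => ?_⟩
  calc ∑ k ∈ univ.erase j, ∏ i, (if c j i = c k i then 1 else b ^ ρ)
      = ∑ k ∈ univ.erase j, (∏ i, if c j i = c k i then 1 else b) ^ ρ := by
        refine sum_congr rfl fun k _ => ?_
        rw [← Real.finsetProd_rpow _ _ fun i _ => hK0 _ _]
        refine prod_congr rfl fun i _ => ?_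
        split_ifs <;> simp
    _ ≤ (∑ k ∈ univ.erase j, ∏ i, if c j i = c k i then 1 else b) ^ ρ :=
        sum_rpow_le_rpow_sum _ (fun k _ => hprod _ _) hρ
    _ ≤ _ := Real.rpow_le_rpow (sum_nonneg fun k _ => hprod _ _) (hc j) (by linarith)

/-! ### Gibbs' inequality and the Gilbert–Varshamov distance. -/

theorem alpha_pos {ε : ℝ} (h0 : 0 < ε) (h1 : ε < 1) : 0 < alpha ε :=
  Real.sqrt_pos.2 (mul_pos h0 (by linarith))

theorem alpha_le_half (ε : ℝ) : alpha ε ≤ 1 / 2 :=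
  Real.sqrt_le_iff.2 ⟨by norm_num, by nlinarith [sq_nonneg (ε - 1 / 2)]⟩

/-- The bracket is minus the relative entropy of `(δ, 1 - δ)` with respect to `(4b, 1) / (1 + 4b)`,
hence the inequality and the equality case below. -/
theorem qaryEntropy_five_add_mul_log {δ b : ℝ} (h0 : 0 < δ) (h1 : δ < 1) (hb : 0 < b) :
    Real.qaryEntropy 5 δ + δ * Real.log b = Real.log (1 + 4 * b) +
      (δ * Real.log (4 * b / (δ * (1 + 4 * b))) +
        (1 - δ) * Real.log (1 / ((1 - δ) * (1 + 4 * b)))) := by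
  have h2 : 0 < 1 - δ := by linarith
  rw [Real.log_div (by positivity) (by positivity), Real.log_div (by positivity) (by positivity),
    Real.log_mul (by positivity) (by positivity), Real.log_mul (by positivity) (by positivity),
    Real.log_mul (by positivity) (by positivity), Real.qaryEntropy, Real.binEntropy,
    Real.log_inv, Real.log_inv, Real.log_one]
  norm_num
  ring

theorem qaryEntropy_five_add_mul_log_le {δ b : ℝ} (h0 : 0 < δ) (h1 : δ < 1) (hb : 0 < b) :
    Real.qaryEntropy 5 δ + δ * Real.log b ≤ Real.log (1 + 4 * b) := by
  have h2 : 0 < 1 - δ := by linarith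
  have e1 := mul_le_mul_of_nonneg_left (Real.log_le_sub_one_of_pos
    (show 0 < 4 * b / (δ * (1 + 4 * b)) by positivity)) h0.le
  have e2 := mul_le_mul_of_nonneg_left (Real.log_le_sub_one_of_pos
    (show 0 < 1 / ((1 - δ) * (1 + 4 * b)) by positivity)) h2.le
  have e3 : δ * (4 * b / (δ * (1 + 4 * b)) - 1) + (1 - δ) * (1 / ((1 - δ) * (1 + 4 * b)) - 1) = 0 := by
    field_simp; ring
  rw [qaryEntropy_five_add_mul_log h0 h1 hb]
  linarith

theorem qaryEntropy_five_add_mul_log_lt {δ b : ℝ} (h0 : 0 < δ) (h1 : δ < 1) (hb : 0 < b)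
    (hne : δ * (1 + 4 * b) ≠ 4 * b) :
    Real.qaryEntropy 5 δ + δ * Real.log b < Real.log (1 + 4 * b) := by
  have h2 : 0 < 1 - δ := by linarith
  have e1 := mul_lt_mul_of_pos_left (Real.log_lt_sub_one_of_pos
    (show 0 < 4 * b / (δ * (1 + 4 * b)) by positivity)
    (fun h => hne ((div_eq_one_iff_eq (by positivity)).1 h).symm)) h0
  have e2 := mul_le_mul_of_nonneg_left (Real.log_le_sub_one_of_pos
    (show 0 < 1 / ((1 - δ) * (1 + 4 * b)) by positivity)) h2.le
  have e3 : δ * (4 * b / (δ * (1 + 4 * b)) - 1) + (1 - δ) * (1 / ((1 - δ) * (1 + 4 * b)) - 1) = 0 := by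
    field_simp; ring
  rw [qaryEntropy_five_add_mul_log h0 h1 hb]
  linarith

theorem qaryEntropy_five_add_mul_log_eq {δ b : ℝ} (h0 : 0 < δ) (h1 : δ < 1) (hb : 0 < b)
    (h : δ * (1 + 4 * b) = 4 * b) :
    Real.qaryEntropy 5 δ + δ * Real.log b = Real.log (1 + 4 * b) := by
  have h' : (1 - δ) * (1 + 4 * b) = 1 := by linarith
  rw [qaryEntropy_five_add_mul_log h0 h1 hb, h, h', div_self (by positivity)]
  simp

theorem qaryEntropy_five_four_fifths : Real.qaryEntropy 5 (4 / 5) = Real.log 5 := by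
  have := qaryEntropy_five_add_mul_log_eq (δ := 4 / 5) (b := 1) (by norm_num) (by norm_num)
    (by norm_num) (by norm_num)
  norm_num at this ⊢
  exact this

/-- The Gilbert-Varshamov distance at rate `2 R - log₂ 5`, in natural logarithms. -/
theorem deltaGV_five_spec {ε R : ℝ} (hR0 : Real.logb 2 (√5) ≤ R) (hR : R ≤ RPlus5 ε) :
    1 - 1 / (1 + 2 * alpha ε) ^ 2 ≤ deltaGV (2 * R - Real.logb 2 5) 5 ∧
    deltaGV (2 * R - Real.logb 2 5) 5 ≤ 4 / 5 ∧
    Real.qaryEntropy 5 (deltaGV (2 * R - Real.logb 2 5) 5) =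
      2 * (Real.log 5 - R * Real.log 2) := by
  have hα0 : 0 ≤ alpha ε := Real.sqrt_nonneg _
  have hα := alpha_le_half ε
  have hlog : 0 < Real.log 2 := Real.log_pos (by norm_num)
  -- As `(1 + 2α) ^ 2 = 1 + 4β` with `β = α(1 + α)`, this is `4β / (1 + 4β)`, the Gibbs equality
  -- point for `b = β`.
  set t := 1 - 1 / (1 + 2 * alpha ε) ^ 2 with ht
  have ht0 : 0 ≤ t := by
    have : 1 / (1 + 2 * alpha ε) ^ 2 ≤ 1 := by
      rw [div_le_one (by positivity)]; nlinarith
    linarith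
  have ht1 : t ≤ 4 / 5 := by
    have : 1 / 5 ≤ 1 / (1 + 2 * alpha ε) ^ 2 :=
      one_div_le_one_div_of_le (by positivity) (by nlinarith)
    linarith
  have hlow : Real.qaryEntropy 5 t ≤ 2 * (Real.log 5 - R * Real.log 2) := by
    rw [RPlus5, entropy, Real.logb, ← ht] at hR
    have := mul_le_mul_of_nonneg_right hR hlog.le
    field_simp at this
    linarith
  have hhigh : 2 * (Real.log 5 - R * Real.log 2) ≤ Real.qaryEntropy 5 (4 / 5) := by
    rw [qaryEntropy_five_four_fifths]
    rw [Real.logb, div_le_iff₀ hlog, Real.log_sqrt (by norm_num)] at hR0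
    linarith
  obtain ⟨δ, ⟨hδ0, hδ1⟩, hδ⟩ := intermediate_value_Icc ht1
    (Real.qaryEntropy_continuous (q := 5)).continuousOn ⟨hlow, hhigh⟩
  have hinj : Set.InjOn (Real.qaryEntropy 5) (Set.Icc 0 (1 - 1 / ((5 : ℕ) : ℝ))) :=
    (Real.qaryEntropy_strictMonoOn (by norm_num)).injOn
  have h45 : (1 - 1 / ((5 : ℕ) : ℝ)) = 4 / 5 := by norm_num
  have hrate : ∀ x, 2 * R - Real.logb 2 5 = Real.logb 2 (5 : ℕ) - entropy 5 x ↔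
      Real.qaryEntropy 5 x = 2 * (Real.log 5 - R * Real.log 2) := fun x => by
    rw [entropy, Real.logb, Real.logb]
    push_cast
    field_simp
    constructor <;> intro h <;> linarith
  have hset : {x : ℝ | 0 ≤ x ∧ x ≤ 1 - 1 / ((5 : ℕ) : ℝ) ∧
      2 * R - Real.logb 2 5 = Real.logb 2 (5 : ℕ) - entropy 5 x} = {δ} := by
    ext x
    simp only [Set.mem_ofPred_eq, Set.mem_singleton_iff, hrate]
    constructor
    · rintro ⟨hx0, hx1, hx⟩
      exact hinj ⟨hx0, hx1⟩ ⟨ht0.trans hδ0, h45 ▸ hδ1⟩ (hx.trans hδ.symm)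
    · rintro rfl
      exact ⟨ht0.trans hδ0, h45 ▸ hδ1, hδ⟩
  have : deltaGV (2 * R - Real.logb 2 5) 5 = δ := by
    rw [deltaGV, hset, csSup_singleton]
  rw [this]
  exact ⟨hδ0, hδ1, hδ⟩

theorem deltaGV_five_pos {ε R : ℝ} (h0 : 0 < ε) (h1 : ε ≤ 1 / 2)
    (hR0 : Real.logb 2 (√5) ≤ R) (hR : R ≤ RPlus5 ε) :
    0 < deltaGV (2 * R - Real.logb 2 5) 5 := by
  have hα0 := alpha_pos h0 (by linarith)
  refine lt_of_lt_of_le ?_ (deltaGV_five_spec hR0 hR).1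
  rw [sub_pos, div_lt_one (by positivity)]
  nlinarith

/-! ### Error probabilities and the achievable exponent. -/

theorem msgError_nonneg {q M n : ℕ} [NeZero q] {ε : ℝ} (h0 : 0 ≤ ε) (h1 : ε ≤ 1)
    (C : Code q M n) (μ : Fin M) : 0 ≤ C.msgError ε μ :=
  sum_nonneg fun y _ => by
    split_ifs
    exacts [le_rfl, channelN_nonneg h0 h1 _ _ _]

theorem avgError_nonneg {q M n : ℕ} [NeZero q] {ε : ℝ} (h0 : 0 ≤ ε) (h1 : ε ≤ 1)
    (C : Code q M n) : 0 ≤ C.avgError ε :=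
  mul_nonneg (by positivity) (sum_nonneg fun μ _ => msgError_nonneg h0 h1 C μ)

theorem maxError_nonneg {q M n : ℕ} [NeZero q] {ε : ℝ} (h0 : 0 ≤ ε) (h1 : ε ≤ 1)
    (C : Code q M n) : 0 ≤ C.maxError ε :=
  Real.iSup_nonneg fun μ => msgError_nonneg h0 h1 C μ

theorem minAvgError_nonneg {q M n : ℕ} [NeZero q] {ε : ℝ} (h0 : 0 ≤ ε) (h1 : ε ≤ 1) :
    0 ≤ minAvgError q ε M n :=
  Real.iInf_nonneg fun C => avgError_nonneg h0 h1 C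

theorem minMaxError_nonneg {q M n : ℕ} [NeZero q] {ε : ℝ} (h0 : 0 ≤ ε) (h1 : ε ≤ 1) :
    0 ≤ minMaxError q ε M n :=
  Real.iInf_nonneg fun C => maxError_nonneg h0 h1 C

theorem minAvgError_le {q M n : ℕ} [NeZero q] {ε S : ℝ} (h0 : 0 ≤ ε) (h1 : ε ≤ 1) (hM : 0 < M)
    (C : Code q M n) (hC : ∀ μ, C.msgError ε μ ≤ S) : minAvgError q ε M n ≤ S := by
  refine (ciInf_le ⟨0, Set.forall_mem_range.2 fun C => avgError_nonneg h0 h1 C⟩ C).trans ?_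
  have hM' : (0 : ℝ) < M := by exact_mod_cast hM
  rw [Code.avgError, one_div, inv_mul_le_iff₀ hM']
  simpa using sum_le_sum fun μ (_ : μ ∈ univ) => hC μ

theorem minMaxError_le {q M n : ℕ} [NeZero q] {ε S : ℝ} (h0 : 0 ≤ ε) (h1 : ε ≤ 1) (hM : 0 < M)
    (C : Code q M n) (hC : ∀ μ, C.msgError ε μ ≤ S) : minMaxError q ε M n ≤ S := by
  have : Nonempty (Fin M) := ⟨⟨0, hM⟩⟩
  exact (ciInf_le ⟨0, Set.forall_mem_range.2 fun C => maxError_nonneg h0 h1 C⟩ C).trans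
    (ciSup_le hC)

theorem le_expRate {m : ℕ} (hm : 0 < m) {p E : ℝ} (hp : 0 ≤ p)
    (hpE : p ≤ Real.exp (-(m * E))) :
    ((1 / 2 * (E / Real.log 2) : ℝ) : EReal) ≤ expRate (m + m) p := by
  unfold expRate
  split_ifs with h
  · exact le_top
  · have hp' : 0 < p := lt_of_le_of_ne hp (Ne.symm h)
    have hlog : 0 < Real.log 2 := Real.log_pos (by norm_num)
    have hm' : (0 : ℝ) < m := by exact_mod_cast hm
    have := (Real.log_le_iff_le_exp hp').2 hpE
    rw [EReal.coe_le_coe_iff, Real.logb, one_div p, Real.log_inv]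
    push_cast
    rw [show 1 / 2 * (E / Real.log 2) = 1 / ((m : ℝ) + m) * (m * E / Real.log 2) by
      field_simp; ring]
    gcongr
    linarith

theorem ceil_two_rpow_le (m : ℕ) (R : ℝ) :
    ⌈(2 : ℝ) ^ (((m + m : ℕ) : ℝ) * R)⌉₊ ≤
      5 ^ m * ⌈(2 : ℝ) ^ ((m : ℝ) * (2 * R - Real.logb 2 5))⌉₊ := by
  refine Nat.ceil_le.2 ?_
  push_cast
  have h5 : (5 : ℝ) ^ m = 2 ^ ((m : ℝ) * Real.logb 2 5) := by
    rw [mul_comm, Real.rpow_mul (by norm_num), Real.rpow_logb (by norm_num) (by norm_num)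
      (by norm_num), Real.rpow_natCast]
  have : (2 : ℝ) ^ (((m : ℝ) + m) * R) = 5 ^ m * 2 ^ ((m : ℝ) * (2 * R - Real.logb 2 5)) := by
    rw [h5, ← Real.rpow_add (by norm_num)]; congr 1; ring
  rw [this]
  gcongr
  exact Nat.le_ceil _

theorem exists_code_msgError_le_exp {ε R : ℝ} (h0 : 0 < ε) (h1 : ε ≤ 1 / 2)
    (hR0 : Real.logb 2 (√5) ≤ R) (hR : R ≤ RPlus5 ε) (m : ℕ) :
    ∃ C : Code 5 ⌈(2 : ℝ) ^ (((m + m : ℕ) : ℝ) * R)⌉₊ (m + m), ∀ μ, C.msgError ε μ ≤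
      Real.exp (-(m * (-(deltaGV (2 * R - Real.logb 2 5) 5 *
        Real.log (alpha ε * (1 + alpha ε)))))) := by
  obtain ⟨hδ0, hδ1, hδ⟩ := deltaGV_five_spec hR0 hR
  have hδpos := deltaGV_five_pos h0 h1 hR0 hR
  set δ := deltaGV (2 * R - Real.logb 2 5) 5
  have hα0 := alpha_pos h0 (by linarith)
  have hα := alpha_le_half ε
  set β := alpha ε * (1 + alpha ε) with hβ
  have hβ0 : 0 < β := by positivity
  have hβ1 : β < 1 := by nlinarith
  have hlog : 0 < Real.log 2 := Real.log_pos (by norm_num)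
  have hMpos : 0 < ⌈(2 : ℝ) ^ (((m + m : ℕ) : ℝ) * R)⌉₊ := Nat.ceil_pos.2 (by positivity)
  have hr : (2 * R - Real.logb 2 5) * Real.log 2 = Real.log 5 - Real.qaryEntropy 5 δ := by
    rw [hδ, Real.logb]; field_simp; ring
  rcases hδ1.lt_or_eq with hlt | heq
  · have h1δ : 0 < 1 - δ := by linarith
    -- Solves `δ = 4b / (1 + 4b)`, so that Gibbs' inequality is an equality.
    set b := δ / (4 * (1 - δ)) with hb
    have hb0 : 0 < b := by positivity
    have hb1 : b < 1 := by rw [hb, div_lt_one (by positivity)]; linarith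
    have hβb : β ≤ b := by
      rw [hb, le_div_iff₀ (by positivity)]
      have : (1 - δ) * (1 + 2 * alpha ε) ^ 2 ≤ 1 := by
        rw [← le_div_iff₀ (by positivity)]; linarith
      rw [hβ]
      nlinarith
    have hlb : Real.log b < 0 := Real.log_neg hb0 hb1
    set ρ := Real.log β / Real.log b with hρ
    have hρ1 : 1 ≤ ρ := by
      rw [hρ, one_le_div_of_neg hlb]
      exact Real.log_le_log hβ0 hβb
    have hbρ : b ^ ρ = β := by
      rw [Real.rpow_def_of_pos hb0, hρ, mul_div_cancel₀ _ hlb.ne, Real.exp_log hβ0]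
    set N := ⌈(2 : ℝ) ^ ((m : ℝ) * (2 * R - Real.logb 2 5))⌉₊ with hN
    have hN1 : (1 : ℝ) ≤ N := by
      exact_mod_cast Nat.one_le_iff_ne_zero.2 (Nat.ceil_pos.2 (by positivity)).ne'
    -- The factor `N - 1`, in place of `N`, absorbs the rounding up.
    have hN2 : (N : ℝ) - 1 ≤ 2 ^ ((m : ℝ) * (2 * R - Real.logb 2 5)) := by
      have := Nat.ceil_lt_add_one (a := (2 : ℝ) ^ ((m : ℝ) * (2 * R - Real.logb 2 5)))
        (by positivity)
      linarith
    obtain ⟨c, hc⟩ := exists_family_sum_pow_le hb0.le hρ1 m N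
    rw [hbρ] at hc
    obtain ⟨C, hC⟩ := exists_code_maxError_le h0.le (by linarith) hMpos (ceil_two_rpow_le m R) c hc
    refine ⟨C, fun μ => (hC μ).trans ?_⟩
    have hgibbs := qaryEntropy_five_add_mul_log_eq hδpos (by linarith) hb0
      (by rw [hb]; field_simp; ring)
    calc ((N - 1) * ((1 + 4 * b) / 5) ^ m) ^ ρ
        ≤ (2 ^ ((m : ℝ) * (2 * R - Real.logb 2 5)) * ((1 + 4 * b) / 5) ^ m) ^ ρ := by
          refine Real.rpow_le_rpow (mul_nonneg (by linarith) (by positivity)) ?_ (by linarith)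
          gcongr
      _ = Real.exp (m * (δ * Real.log b)) ^ ρ := by
          congr 1
          rw [Real.rpow_def_of_pos (by norm_num), ← Real.rpow_natCast,
            Real.rpow_def_of_pos (by positivity), ← Real.exp_add,
            Real.log_div (by positivity) (by norm_num), ← hgibbs]
          congr 1
          linear_combination (m : ℝ) * hr
      _ = Real.exp (-(m * (-(δ * Real.log β)))) := by
          rw [← Real.exp_mul, ← hbρ, Real.log_rpow hb0]
          congr 1
          ring
  -- At `δ = 4/5` one would get `b = 1` and `ρ` undefined. Here `R = log √5`, and a single
  -- translate, with zero error, is enough.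
  · have hr0 : 2 * R - Real.logb 2 5 = 0 := by
      rw [heq, qaryEntropy_five_four_fifths, sub_self] at hr
      exact (mul_eq_zero.1 hr).resolve_right hlog.ne'
    have hMN := ceil_two_rpow_le m R
    rw [hr0, mul_zero, Real.rpow_zero, Nat.ceil_one] at hMN
    obtain ⟨C, hC⟩ := exists_code_maxError_le (S := 0) h0.le (by linarith) hMpos hMN
      (fun _ _ => 0) (fun j => by rw [Subsingleton.elim j 0]; simp)
    exact ⟨C, fun μ => (hC μ).trans (Real.exp_pos _).le⟩

theorem newBound5_eq (ε R : ℝ) : newBound5 ε R = 1 / 2 * (-(deltaGV (2 * R - Real.logb 2 5) 5 *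
    Real.log (alpha ε * (1 + alpha ε))) / Real.log 2) := by
  simp only [newBound5, Real.logb]
  ring

/-- Even lengths suffice because the reliability function is a limsup. -/
theorem newBound5_le_limsup {ε R : ℝ} (p : ℕ → ℝ) (hp : ∀ n, 0 ≤ p n)
    (hpE : ∀ m : ℕ, p (m + m) ≤ Real.exp (-(m * (-(deltaGV (2 * R - Real.logb 2 5) 5 *
        Real.log (alpha ε * (1 + alpha ε))))))) :
    (newBound5 ε R : EReal) ≤ Filter.limsup (fun n => expRate n (p n)) Filter.atTop := by
  refine Filter.le_limsup_of_frequently_le (Filter.frequently_atTop.2 fun a => ?_)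
  refine ⟨(a + 1) + (a + 1), by omega, ?_⟩
  rw [newBound5_eq]
  exact le_expRate a.succ_pos (hp _) (hpE _)

/-! ### Upper bound on the multiletter expurgated exponent. -/

theorem quadForm_eq {ε ρ : ℝ} (h0 : 0 ≤ ε) (h1 : ε ≤ 1) (hρ : ρ ≠ 0) (k : ℕ)
    (P : (Fin k → ZMod 5) → ℝ) : quadForm 5 ε k ρ P =
      ∑ x, ∑ y, P x * P y * ∏ i, circulant (alpha ε ^ (1 / ρ)) 0 (x i) (y i) := by
  have hα : 0 ≤ alpha ε := Real.sqrt_nonneg _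
  simp only [quadForm, bhatt_eq_prod h0 h1, ← circulant_rpow _ (one_div_ne_zero hρ),
    Real.finsetProd_rpow _ _ (fun _ _ => circulant_nonneg hα _ _)]

/-- The kernel is entrywise monotone and `P` is nonnegative, so the off-diagonal value may be
lowered to one in the positive semidefinite range. -/
theorem le_quadForm {ε ρ a : ℝ} (h0 : 0 ≤ ε) (h1 : ε ≤ 1) (hρ : ρ ≠ 0) (ha0 : 0 ≤ a)
    (ha : a ≤ (√5 - 1) / 2) (haα : a ≤ alpha ε ^ (1 / ρ)) (k : ℕ)
    (P : stdSimplex ℝ (Fin k → ZMod 5)) :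
    ((1 + 2 * a) / 5) ^ k ≤ quadForm 5 ε k ρ P.1 := by
  obtain ⟨w, B, hw, hw0, hB, hK⟩ := exists_circulant_decomposition ha0 ha
  rw [quadForm_eq h0 h1 hρ, ← hw0]
  refine (pow_le_quadraticForm hw hK hB k P.2.2).trans ?_
  refine sum_le_sum fun x _ => sum_le_sum fun y _ => mul_le_mul_of_nonneg_left ?_
    (mul_nonneg (P.2.1 x) (P.2.1 y))
  exact prod_le_prod (fun i _ => circulant_nonneg ha0 _ _) fun i _ => circulant_mono haα _ _

theorem exFun_le {ε ρ a : ℝ} (h0 : 0 ≤ ε) (h1 : ε ≤ 1) (hρ : 0 < ρ) (ha0 : 0 ≤ a)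
    (ha : a ≤ (√5 - 1) / 2) (haα : a ≤ alpha ε ^ (1 / ρ)) {k : ℕ} (hk : 1 ≤ k) :
    exFun 5 ε k ρ ≤ ρ * (Real.logb 2 5 - Real.logb 2 (1 + 2 * a)) := by
  have hne : Nonempty (stdSimplex ℝ (Fin k → ZMod 5)) := inferInstance
  have hk' : (0 : ℝ) < k := by exact_mod_cast hk
  have hle : k * Real.logb 2 ((1 + 2 * a) / 5) ≤
      Real.logb 2 (⨅ P : stdSimplex ℝ (Fin k → ZMod 5), quadForm 5 ε k ρ P.1) := by
    rw [← Real.logb_pow]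
    exact Real.logb_le_logb_of_le (by norm_num) (by positivity)
      (le_ciInf fun P => le_quadForm h0 h1 hρ.ne' ha0 ha haα k P)
  rw [Real.logb_div (by positivity) (by norm_num)] at hle
  have := mul_le_mul_of_nonneg_left hle (show 0 ≤ ρ / k by positivity)
  rw [exFun]
  calc -(ρ / k) * Real.logb 2 (⨅ P : stdSimplex ℝ (Fin k → ZMod 5), quadForm 5 ε k ρ P.1)
      ≤ -(ρ / k * (k * (Real.logb 2 (1 + 2 * a) - Real.logb 2 5))) := by linarith
    _ = ρ * (Real.logb 2 5 - Real.logb 2 (1 + 2 * a)) := by field_simp; ring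

theorem add_rpow_lt_rpow_add_rpow {x y p : ℝ} (hx : 0 < x) (hy : 0 < y) (hp : p < 1) :
    (x + y) ^ p < x ^ p + y ^ p := by
  have hsplit : ∀ z : ℝ, 0 < z → z ^ p = z * z ^ (p - 1) := fun z hz => by
    rw [Real.rpow_sub_one hz.ne']; field_simp
  have e1 := Real.rpow_lt_rpow_of_neg hx (show x < x + y by linarith) (show p - 1 < 0 by linarith)
  have e2 := Real.rpow_lt_rpow_of_neg hy (show y < x + y by linarith) (show p - 1 < 0 by linarith)
  rw [hsplit _ hx, hsplit _ hy, hsplit _ (add_pos hx hy), add_mul]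
  gcongr

/-- Every term of the single letter expurgated exponent is below the new bound. -/
theorem expurgated_term_lt_newBound5 {ε R ρ : ℝ} (h0 : 0 < ε) (h1 : ε ≤ 1 / 2)
    (hR0 : Real.logb 2 (√5) ≤ R) (hR : R < RPlus5 ε) (hρ : 1 ≤ ρ) :
    ρ * (Real.logb 2 5 - Real.logb 2 (1 + 2 * alpha ε ^ (1 / ρ)) - R) < newBound5 ε R := by
  obtain ⟨hδ0, hδ1, hδ⟩ := deltaGV_five_spec hR0 hR.le
  have hδpos := deltaGV_five_pos h0 h1 hR0 hR.le
  rw [newBound5_eq]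
  set δ := deltaGV (2 * R - Real.logb 2 5) 5
  have hα0 := alpha_pos h0 (by linarith)
  have hlog : 0 < Real.log 2 := Real.log_pos (by norm_num)
  have hρ0 : 0 < ρ := by linarith
  set α := alpha ε with hα
  set β := α * (1 + α) with hβ
  have hβ0 : 0 < β := by positivity
  set a := α ^ (1 / ρ) with ha
  have ha0 : 0 < a := by positivity
  set b := β ^ (1 / ρ) with hb
  have hb0 : 0 < b := by positivity
  have hlogb : ρ * Real.log b = Real.log β := by
    rw [hb, Real.log_rpow hβ0]; field_simp
  have hsq : 2 * Real.log (1 + 2 * a) = Real.log (1 + 4 * (a + a ^ 2)) := by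
    rw [show 1 + 4 * (a + a ^ 2) = (1 + 2 * a) ^ 2 by ring, Real.log_pow]; norm_num
  -- Strictness has two sources: for `ρ = 1`, `R < R₊*` excludes Gibbs equality; for `ρ > 1`, strict
  -- subadditivity gives `b < a + a ^ 2`.
  have key : Real.qaryEntropy 5 δ + δ * Real.log b < Real.log (1 + 4 * (a + a ^ 2)) := by
    rcases hρ.eq_or_lt with rfl | hlt
    · have hab : a + a ^ 2 = b := by
        rw [ha, hb, div_one, Real.rpow_one, Real.rpow_one, hβ]; ring
      rw [hab]
      refine qaryEntropy_five_add_mul_log_lt hδpos (by linarith) hb0 fun h => ?_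
      have hb1 : b = β := by rw [hb, div_one, Real.rpow_one]
      have hδt : δ = 1 - 1 / (1 + 2 * α) ^ 2 := by
        rw [hb1, hβ] at h
        field_simp
        linarith
      have : RPlus5 ε = R := by
        rw [RPlus5, entropy, ← hα, ← hδt, hδ, Real.logb]
        field_simp
        ring
      linarith
    · refine (qaryEntropy_five_add_mul_log_le hδpos (by linarith) hb0).trans_lt ?_
      refine Real.log_lt_log (by positivity) ?_
      have hlt' : b < a + a ^ 2 := by
        have h2 : a ^ 2 = (α ^ 2) ^ (1 / ρ) := by
          rw [ha, ← Real.rpow_natCast, ← Real.rpow_natCast, ← Real.rpow_mul hα0.le,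
            ← Real.rpow_mul hα0.le, mul_comm]
        rw [h2, hb, show β = α + α ^ 2 by rw [hβ]; ring]
        exact add_rpow_lt_rpow_add_rpow hα0 (by positivity) ((div_lt_one hρ0).2 hlt)
      linarith
  rw [← hsq, hδ] at key
  have key2 := mul_lt_mul_of_pos_left key hρ0
  rw [show ρ * (Real.logb 2 5 - Real.logb 2 (1 + 2 * a) - R) =
    ρ * (Real.log 5 - Real.log (1 + 2 * a) - R * Real.log 2) / Real.log 2 by
      rw [Real.logb, Real.logb]; field_simp,
    ← mul_div_assoc]
  refine div_lt_div_of_pos_right ?_ hlog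
  rw [← hlogb]
  linarith

theorem newBound5_pos {ε R : ℝ} (h0 : 0 < ε) (h1 : ε ≤ 1 / 2)
    (hR0 : Real.logb 2 (√5) ≤ R) (hR : R ≤ RPlus5 ε) : 0 < newBound5 ε R := by
  have hα0 := alpha_pos h0 (by linarith)
  have hα := alpha_le_half ε
  have hδpos := deltaGV_five_pos h0 h1 hR0 hR
  have hβ : Real.logb 2 (alpha ε * (1 + alpha ε)) < 0 :=
    Real.logb_neg (by norm_num) (by positivity) (by nlinarith)
  rw [newBound5]
  nlinarith [mul_pos hδpos (neg_pos.2 hβ)]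

theorem expurgatedInf_lt_newBound5 {ε R : ℝ} (h0 : 0 < ε) (h1 : ε ≤ 1 / 2)
    (hR0 : Real.logb 2 (√5) ≤ R) (hR : R < RPlus5 ε) :
    expurgatedInf 5 ε R < (newBound5 ε R : EReal) := by
  have hα0 := alpha_pos h0 (by linarith)
  have hα := alpha_le_half ε
  have hs : √5 ^ 2 = 5 := Real.sq_sqrt (by norm_num)
  have hs2 : 2 < √5 := Real.lt_sqrt_of_sq_lt (by norm_num)
  have hs3 : √5 < 3 := by nlinarith
  set g := (√5 - 1) / 2 with hg
  have hg0 : 0 < g := by linarith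
  have hlg : Real.log g < 0 := Real.log_neg hg0 (by linarith)
  -- The value of `ρ` at which `α ^ (1/ρ)` reaches the threshold `g` of semidefiniteness.
  set r := Real.log (alpha ε) / Real.log g with hr
  have hle : ∀ ρ : ℝ, 0 < ρ → (alpha ε ^ (1 / ρ) ≤ g ↔ ρ ≤ r) := fun ρ hρ => by
    rw [hr, le_div_iff_of_neg hlg, ← Real.log_le_log_iff (by positivity) hg0,
      Real.log_rpow hα0, one_div, inv_mul_le_iff₀ hρ]
  have hr1 : 1 ≤ r := (hle 1 one_pos).1 (by rw [div_one, Real.rpow_one]; linarith)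
  let F : ℝ → ℝ := fun ρ => ρ * (Real.logb 2 5 - Real.logb 2 (1 + 2 * alpha ε ^ (1 / ρ)) - R)
  have hF : ContinuousOn F (Set.Icc 1 r) := by
    have hinv : ContinuousOn (fun ρ : ℝ => 1 / ρ) (Set.Icc 1 r) :=
      continuousOn_const.div continuousOn_id fun ρ hρ =>
        (zero_lt_one.trans_le hρ.1).ne'
    refine continuousOn_id.mul ((continuousOn_const.sub ?_).sub continuousOn_const)
    refine (ContinuousOn.log ?_ fun ρ _ => ?_).div_const _
    · exact continuousOn_const.add (continuousOn_const.mul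
        (continuousOn_const.rpow hinv fun _ _ => Or.inl hα0.ne'))
    · positivity
  -- An attained maximum is needed: termwise strict inequalities alone would not survive the
  -- supremum.
  obtain ⟨ρ₀, hρ₀, hmax⟩ := isCompact_Icc.exists_isMaxOn (Set.nonempty_Icc.2 hr1) hF
  have hbound : expurgatedInf 5 ε R ≤ ((max (F ρ₀) 0 : ℝ) : EReal) := by
    refine iSup₂_le fun k hk => iSup₂_le fun ρ hρ => EReal.coe_le_coe_iff.2 ?_
    have hρ0 : 0 < ρ := by linarith
    rcases le_or_gt ρ r with h | h
    · refine le_max_of_le_left (le_trans ?_ (hmax ⟨hρ, h⟩))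
      have := exFun_le h0.le (by linarith) hρ0 (by positivity) ((hle ρ hρ0).2 h) le_rfl hk
      simp only [F]
      linarith
    · refine le_max_of_le_right ?_
      have hga : g ≤ alpha ε ^ (1 / ρ) := le_of_not_ge fun h' => absurd ((hle ρ hρ0).1 h') h.not_ge
      have := exFun_le h0.le (by linarith) hρ0 hg0.le le_rfl hga hk
      have hlog5 : Real.logb 2 5 = 2 * Real.logb 2 (√5) := by
        rw [← hs, Real.logb_pow]; simp
      -- With `1 + 2g = √5` the term is at most `ρ (log √5 - R) ≤ 0`.
      rw [show 1 + 2 * g = √5 by rw [hg]; ring, hlog5] at this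
      nlinarith
  refine hbound.trans_lt (EReal.coe_lt_coe_iff.2 (max_lt ?_ (newBound5_pos h0 h1 hR0 hR.le)))
  exact expurgated_term_lt_newBound5 h0 h1 hR0 hR hρ₀.1

end Typewriter

theorem theorem3 (ε : ℝ) (hε0 : 0 < ε) (hε : ε ≤ 1 / 2) (R : ℝ)
    (hR0 : Real.logb 2 (Real.sqrt 5) ≤ R) (hR : R ≤ Typewriter.RPlus5 ε) :
    (Typewriter.newBound5 ε R : EReal) ≤ Typewriter.reliability 5 ε R ∧
    (Typewriter.newBound5 ε R : EReal) ≤ Typewriter.reliabilityMax 5 ε R ∧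
    (R < Typewriter.RPlus5 ε →
      Typewriter.expurgatedInf 5 ε R < (Typewriter.newBound5 ε R : EReal)) := by
  have hε1 : ε ≤ 1 := by linarith
  refine ⟨?_, ?_, fun h => Typewriter.expurgatedInf_lt_newBound5 hε0 hε hR0 h⟩
  · refine Typewriter.newBound5_le_limsup _
      (fun n => Typewriter.minAvgError_nonneg hε0.le hε1) fun m => ?_
    obtain ⟨C, hC⟩ := Typewriter.exists_code_msgError_le_exp hε0 hε hR0 hR m
    exact Typewriter.minAvgError_le hε0.le hε1 (Nat.ceil_pos.2 (by positivity)) C hC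
  · refine Typewriter.newBound5_le_limsup _
      (fun n => Typewriter.minMaxError_nonneg hε0.le hε1) fun m => ?_
    obtain ⟨C, hC⟩ := Typewriter.exists_code_msgError_le_exp hε0 hε hR0 hR m
    exact Typewriter.minMaxError_le hε0.le hε1 (Nat.ceil_pos.2 (by positivity)) C hC
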